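/- Let $k$ be a field of characteristic zero (for instance $k=\mathbb{C}$ or $k=\mathbb{Q}$), let $0\le a\le n$ be integers, and let $Sp(2n)\subset GL_{2n}(k)$ be the symplectic group over $k$. Let $Sp(2a)\times Sp(2n-2a)\subset Sp(2n)$ be the block-diagonal subgroup attached to the orthogonal decomposition of the standard symplectic space $k^{2n}=k^{2a}\perp k^{2n-2a}$, and let $H=g\,\bigl(Sp(2a)\times Sp(2n-2a)\bigr)\,g^{-1}$ with $g\in Sp(2n)$. Let $G$ be a Zariski-closed subgroup of $Sp(2n)$ that is connected in the Zariski topology and semisimple, i.e. has no non-trivial Zariski-closed connected solvable normal subgroup. If $H\subseteq G$, then $G=H$ or $G=Sp(2n)$. -/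

import Mathlib

namespace SpSub

open Matrix

/-- The embedding of `Sp(2|l|) × Sp(2|m|)` into `Sp(2|p|)`, for a partition `e : l ⊕ m ≃ p` of the
index set.  The pair `(A, B)` goes to the block diagonal matrix `diag(A, B)`, with its coordinates
`(l ⊕ l) ⊕ (m ⊕ m)` rearranged as `(l ⊕ m) ⊕ (l ⊕ m)` and then renamed to `p ⊕ p`. -/
def prodMatrix {k l m p : Type*} [Field k] (e : l ⊕ m ≃ p)
    (A : Matrix (l ⊕ l) (l ⊕ l) k) (B : Matrix (m ⊕ m) (m ⊕ m) k) :
    Matrix (p ⊕ p) (p ⊕ p) k :=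
  Matrix.reindex ((Equiv.sumSumSumComm l l m m).trans (Equiv.sumCongr e e))
    ((Equiv.sumSumSumComm l l m m).trans (Equiv.sumCongr e e))
    (Matrix.fromBlocks A 0 0 B)

section

set_option linter.unusedSectionVars false

variable {k l m p : Type*} [Field k] [Fintype l] [DecidableEq l] [Fintype m] [DecidableEq m]
  [Fintype p] [DecidableEq p]

theorem prodMatrix_J (e : l ⊕ m ≃ p) :
    prodMatrix e (Matrix.J l k) (Matrix.J m k) = Matrix.J p k := by
  ext i j
  obtain ⟨i, rfl⟩ := ((Equiv.sumSumSumComm l l m m).trans (Equiv.sumCongr e e)).surjective i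
  obtain ⟨j, rfl⟩ := ((Equiv.sumSumSumComm l l m m).trans (Equiv.sumCongr e e)).surjective j
  rcases i with (i | i) | (i | i) <;> rcases j with (j | j) | (j | j) <;>
    simp [prodMatrix, Matrix.J, Matrix.one_apply]

theorem prodMatrix_mul (e : l ⊕ m ≃ p) (A A' : Matrix (l ⊕ l) (l ⊕ l) k)
    (B B' : Matrix (m ⊕ m) (m ⊕ m) k) :
    prodMatrix e A B * prodMatrix e A' B' = prodMatrix e (A * A') (B * B') := by
  simp only [prodMatrix, Matrix.reindex_apply, Matrix.submatrix_mul_equiv,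
    Matrix.fromBlocks_multiply, Matrix.mul_zero, Matrix.zero_mul, _root_.add_zero, _root_.zero_add]

theorem prodMatrix_transpose (e : l ⊕ m ≃ p) (A : Matrix (l ⊕ l) (l ⊕ l) k)
    (B : Matrix (m ⊕ m) (m ⊕ m) k) :
    (prodMatrix e A B)ᵀ = prodMatrix e Aᵀ Bᵀ := by
  simp [prodMatrix, Matrix.fromBlocks_transpose]

theorem prodMatrix_one (e : l ⊕ m ≃ p) :
    prodMatrix e (1 : Matrix (l ⊕ l) (l ⊕ l) k) (1 : Matrix (m ⊕ m) (m ⊕ m) k) = 1 := by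
  simp only [prodMatrix, Matrix.reindex_apply, Matrix.fromBlocks_one, Matrix.submatrix_one_equiv]

end

/-- `prodMatrix` as a group homomorphism `Sp(2|l|) × Sp(2|m|) → Sp(2|p|)`. -/
def prodHom (k : Type*) {l m p : Type*} [Field k] [Fintype l] [DecidableEq l] [Fintype m]
    [DecidableEq m] [Fintype p] [DecidableEq p] (e : l ⊕ m ≃ p) :
    (Matrix.symplecticGroup l k × Matrix.symplecticGroup m k) →* Matrix.symplecticGroup p k where
  toFun x := ⟨prodMatrix e x.1.1 x.2.1, by
    rw [SymplecticGroup.mem_iff, ← prodMatrix_J e, prodMatrix_transpose, prodMatrix_mul,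
      prodMatrix_mul, SymplecticGroup.mem_iff.1 x.1.2, SymplecticGroup.mem_iff.1 x.2.2]⟩
  map_one' := Subtype.ext (prodMatrix_one e)
  map_mul' x y := Subtype.ext (prodMatrix_mul e _ _ _ _).symm

/-- The subgroup `Sp(2a) × Sp(2n - 2a)` of `Sp(2n)`: the first factor acts on the coordinate pairs
with index `< a`, the second on the others. -/
def spProd (k : Type*) [Field k] {a n : ℕ} (h : a ≤ n) :
    Subgroup (Matrix.symplecticGroup (Fin n) k) :=
  (prodHom k (finSumFinEquiv.trans (finCongr (Nat.add_sub_of_le h)) :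
    Fin a ⊕ Fin (n - a) ≃ Fin n)).range

/-- The common zeros, among the matrices over `k`, of a set of polynomials in the entries. -/
def matrixZeros {k ι : Type*} [Field k] (P : Set (MvPolynomial (ι × ι) k)) :
    Set (Matrix ι ι k) :=
  {M | ∀ f ∈ P, MvPolynomial.eval (fun ij : ι × ι => M ij.1 ij.2) f = 0}

/-- The Zariski topology on the space of matrices: the closed sets are the sets of common zeros of
polynomials in the entries. -/
abbrev zariskiMatrix (k ι : Type*) [Field k] : TopologicalSpace (Matrix ι ι k) :=
  TopologicalSpace.ofClosed (Set.range matrixZeros)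
    ⟨{1}, by ext M; simp [matrixZeros]⟩
    (by
      intro A hA
      refine ⟨{f | ∃ P, matrixZeros P ∈ A ∧ f ∈ P}, ?_⟩
      ext M
      simp only [matrixZeros, Set.mem_ofPred_eq, Set.mem_sInter]
      constructor
      · intro h t ht
        obtain ⟨P, rfl⟩ := hA ht
        exact fun f hf => h f ⟨P, ht, hf⟩
      · rintro h f ⟨P, hP, hf⟩
        exact h _ hP f hf)
    (by
      rintro _ ⟨P, rfl⟩ _ ⟨Q, rfl⟩
      refine ⟨{f | ∃ p ∈ P, ∃ q ∈ Q, f = p * q}, ?_⟩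
      ext M
      simp only [matrixZeros, Set.mem_ofPred_eq, Set.mem_union]
      constructor
      · intro h
        by_contra! hc
        obtain ⟨⟨p, hp, hp0⟩, ⟨q, hq, hq0⟩⟩ := hc
        have := h _ ⟨p, hp, q, hq, rfl⟩
        rw [map_mul] at this
        exact (mul_ne_zero hp0 hq0) this
      · rintro (h | h) f ⟨p, hp, q, hq, rfl⟩
        · rw [map_mul, h p hp, zero_mul]
        · rw [map_mul, h q hq, mul_zero])

/-- The Zariski topology on the symplectic group `Sp(2n)` over `k`. -/
abbrev zariskiSp (k : Type*) [Field k] (n : ℕ) :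
    TopologicalSpace (Matrix.symplecticGroup (Fin n) k) :=
  TopologicalSpace.induced Subtype.val (zariskiMatrix k (Fin n ⊕ Fin n))

/-- A Zariski-closed, that is, algebraic, subgroup of `Sp(2n)`. -/
def IsAlgebraicSubgroup {k : Type*} [Field k] {n : ℕ}
    (G : Subgroup (Matrix.symplecticGroup (Fin n) k)) : Prop :=
  @IsClosed _ (zariskiSp k n) (G : Set (Matrix.symplecticGroup (Fin n) k))

/-- A subgroup of `Sp(2n)` that is connected in the Zariski topology. -/
def IsConnectedSubgroup {k : Type*} [Field k] {n : ℕ}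
    (G : Subgroup (Matrix.symplecticGroup (Fin n) k)) : Prop :=
  @IsConnected _ (zariskiSp k n) (G : Set (Matrix.symplecticGroup (Fin n) k))

/-- Semisimplicity of an algebraic subgroup `G` of `Sp(2n)` (over a field of characteristic zero):
the radical is trivial, that is, `G` has no connected solvable normal algebraic subgroup other than
the trivial one. -/
def IsSemisimpleSubgroup {k : Type*} [Field k] {n : ℕ}
    (G : Subgroup (Matrix.symplecticGroup (Fin n) k)) : Prop :=
  ∀ N : Subgroup (Matrix.symplecticGroup (Fin n) k), N ≤ G → (N.subgroupOf G).Normal →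
    IsAlgebraicSubgroup N → IsConnectedSubgroup N → Group.IsSolvable N → N = ⊥

end SpSub

/-!
Let `V = k^{2n}` be the standard symplectic space with form `ω`. After conjugation by `g`, the
subgroup `H` is the stabilizer of the two factors of an orthogonal decomposition `V = V₁ ⊥ V₂` into
coordinate subspaces (`mem_range_prodHom`). It contains all transvections `x ↦ x + c ω(v, x) v` with
`v ∈ V₁` or `v ∈ V₂`; hence so does `G`.

Suppose that some `y ∈ G` neither preserves nor exchanges `V₁` and `V₂`. Then `y` maps a vector `v`
of one of them to a vector `z` outside both, and conjugating the transvections along `v` by `y`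
shows that `G` contains all transvections along `z` (`conj_transvection`, `eq_top_or_mapsCoord`).
Both components of `z` are nonzero. The transvections along `V₁` act transitively on the nonzero
vectors of `V₁` and trivially on `V₂`, and vice versa (`exists_mulVec_eq`), so `z` can be moved by
`G` to every other vector with both components nonzero. Thus `G` contains all transvections, and
these generate `Sp(2n)` (`eq_top_of_transvection_mem`).

Otherwise `G` is covered by the Zariski-closed sets of the elements that preserve, respectively
exchange, `V₁` and `V₂` (`isClosed_preimage_conj_mapsCoord`). For `n > 0` these sets are disjoint,
so the connected group `G` lies in the one that contains the identity, which is `H`.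
-/

namespace SpSub

open Matrix

/-! ### Coordinate subspaces -/

section CoordSubspace

variable {k p : Type*} [Field k]

/-- The subspace of `k^{2p}` spanned by the coordinate pairs with index in `s`. -/
def coordSubspace (k : Type*) {p : Type*} [Field k] (s : Set p) : Submodule k (p ⊕ p → k) where
  carrier := {x | ∀ i ∉ s, x (.inl i) = 0 ∧ x (.inr i) = 0}
  add_mem' hx hy i hi := by simp [hx i hi, hy i hi]
  zero_mem' i _ := by simp
  smul_mem' c x hx i hi := by simp [hx i hi]

theorem exists_add_of_coordSubspace (s : Set p) (x : p ⊕ p → k) :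
    ∃ x₁ ∈ coordSubspace k s, ∃ x₂ ∈ coordSubspace k sᶜ, x = x₁ + x₂ := by
  classical
  refine ⟨fun j => if Sum.elim id id j ∈ s then x j else 0, fun i hi => ?_,
    fun j => if Sum.elim id id j ∈ s then 0 else x j, fun i hi => ?_, ?_⟩
  · simp [hi]
  · simp [not_not.1 hi]
  · ext j
    by_cases h : Sum.elim id id j ∈ s <;> simp [h]

theorem single_inl_mem_coordSubspace [DecidableEq p] {s : Set p} {i : p} (hi : i ∈ s) :
    (Pi.single (.inl i) 1 : p ⊕ p → k) ∈ coordSubspace k s := fun j hj => by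
  have : j ≠ i := fun h => hj (h ▸ hi)
  simp [this]

theorem single_inr_mem_coordSubspace [DecidableEq p] {s : Set p} {i : p} (hi : i ∈ s) :
    (Pi.single (.inr i) 1 : p ⊕ p → k) ∈ coordSubspace k s := fun j hj => by
  have : j ≠ i := fun h => hj (h ▸ hi)
  simp [this]

end CoordSubspace

/-! ### Symplectic transvections -/

section Transvections

variable {k p : Type*} [Field k] [Fintype p] [DecidableEq p]

/-- The standard symplectic form on `k^{2p}`, the bilinear form with matrix `Matrix.J p k`. -/
def sympForm (k p : Type*) [Field k] [Fintype p] [DecidableEq p] :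
    (p ⊕ p → k) →ₗ[k] (p ⊕ p → k) →ₗ[k] k :=
  Matrix.toLinearMap₂' k (J p k)

theorem sympForm_eq_dotProduct (x y : p ⊕ p → k) : sympForm k p x y = x ⬝ᵥ (J p k *ᵥ y) :=
  Matrix.toLinearMap₂'_apply' _ _ _

theorem sympForm_apply (x y : p ⊕ p → k) :
    sympForm k p x y = ∑ i, (x (.inr i) * y (.inl i) - x (.inl i) * y (.inr i)) := by
  rw [sympForm_eq_dotProduct, J, fromBlocks_mulVec, dotProduct, Fintype.sum_sum_type,
    ← Finset.sum_add_distrib]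
  refine Finset.sum_congr rfl fun i _ => ?_
  simp [neg_mulVec]
  ring

@[simp]
theorem sympForm_self (x : p ⊕ p → k) : sympForm k p x x = 0 := by
  rw [sympForm_apply]
  exact Finset.sum_eq_zero fun i _ => by ring

theorem sympForm_swap (x y : p ⊕ p → k) : sympForm k p x y = -sympForm k p y x := by
  rw [sympForm_apply, sympForm_apply, ← Finset.sum_neg_distrib]
  exact Finset.sum_congr rfl fun i _ => by ring

theorem sympForm_single_inl (i : p) (x : p ⊕ p → k) :
    sympForm k p (Pi.single (.inl i) 1) x = -x (.inr i) := by
  simp [sympForm_apply, Pi.single_apply]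

theorem sympForm_single_inr (i : p) (x : p ⊕ p → k) :
    sympForm k p (Pi.single (.inr i) 1) x = x (.inl i) := by
  simp [sympForm_apply, Pi.single_apply]

theorem sympForm_mulVec_mulVec {A : Matrix (p ⊕ p) (p ⊕ p) k} (hA : A ∈ symplecticGroup p k)
    (x y : p ⊕ p → k) : sympForm k p (A *ᵥ x) (A *ᵥ y) = sympForm k p x y := by
  rw [SymplecticGroup.mem_iff'] at hA
  rw [sympForm_eq_dotProduct, sympForm_eq_dotProduct]
  conv_rhs => rw [← hA]
  simp only [← mulVec_mulVec, dotProduct_mulVec, vecMul_transpose]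

theorem mem_symplecticGroup_of_sympForm {A : Matrix (p ⊕ p) (p ⊕ p) k}
    (h : ∀ x y, sympForm k p (A *ᵥ x) (A *ᵥ y) = sympForm k p x y) :
    A ∈ symplecticGroup p k := by
  rw [SymplecticGroup.mem_iff']
  refine Matrix.toBilin'.injective (LinearMap.ext₂ fun x y => ?_)
  have := h x y
  rw [sympForm_eq_dotProduct, sympForm_eq_dotProduct] at this
  rw [Matrix.toBilin'_apply', Matrix.toBilin'_apply', ← this]
  simp only [← mulVec_mulVec, dotProduct_mulVec, vecMul_transpose]

theorem one_add_smul_vecMulVec_mulVec (v : p ⊕ p → k) (c : k) (x : p ⊕ p → k) :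
    (1 + c • vecMulVec v (v ᵥ* J p k)) *ᵥ x = x + (c * sympForm k p v x) • v := by
  rw [sympForm_eq_dotProduct, add_mulVec, one_mulVec, smul_mulVec, vecMulVec_mulVec,
    ← dotProduct_mulVec, mul_smul]
  simp

/-- The symplectic transvection `x ↦ x + c ω(v, x) v`. -/
def transvection (v : p ⊕ p → k) (c : k) : symplecticGroup p k :=
  ⟨1 + c • vecMulVec v (v ᵥ* J p k), by
    refine mem_symplecticGroup_of_sympForm fun x y => ?_
    rw [one_add_smul_vecMulVec_mulVec, one_add_smul_vecMulVec_mulVec]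
    simp only [map_add, map_smul, LinearMap.add_apply, LinearMap.smul_apply, smul_eq_mul,
      sympForm_self, sympForm_swap x v]
    ring⟩

theorem transvection_mulVec (v : p ⊕ p → k) (c : k) (x : p ⊕ p → k) :
    (transvection v c).1 *ᵥ x = x + (c * sympForm k p v x) • v :=
  one_add_smul_vecMulVec_mulVec v c x

theorem symplecticGroup_ext {y z : symplecticGroup p k}
    (h : ∀ x, y.1 *ᵥ x = z.1 *ᵥ x) : y = z :=
  Subtype.ext (Matrix.toLin'.injective (LinearMap.ext h))

theorem mul_mulVec (y z : symplecticGroup p k) (x : p ⊕ p → k) :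
    (y * z).1 *ᵥ x = y.1 *ᵥ (z.1 *ᵥ x) :=
  (mulVec_mulVec x y.1 z.1).symm

theorem mulVec_inv_mulVec (y : symplecticGroup p k) (x : p ⊕ p → k) :
    y.1 *ᵥ (y⁻¹.1 *ᵥ x) = x := by
  rw [← mul_mulVec, mul_inv_cancel]
  exact one_mulVec x

theorem inv_mulVec_mulVec (y : symplecticGroup p k) (x : p ⊕ p → k) :
    y⁻¹.1 *ᵥ (y.1 *ᵥ x) = x := by
  rw [← mul_mulVec, inv_mul_cancel]
  exact one_mulVec x

theorem mulVec_ne_zero {y : symplecticGroup p k} {x : p ⊕ p → k} (hx : x ≠ 0) :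
    y.1 *ᵥ x ≠ 0 := fun h => hx (by simpa [h] using (inv_mulVec_mulVec y x).symm)

theorem conj_transvection (y : symplecticGroup p k) (v : p ⊕ p → k) (c : k) :
    y * transvection v c * y⁻¹ = transvection (y.1 *ᵥ v) c := by
  refine symplecticGroup_ext fun x => ?_
  rw [mul_mulVec, mul_mulVec, transvection_mulVec, transvection_mulVec, mulVec_add,
    mulVec_inv_mulVec, mulVec_smul]
  conv_rhs => rw [← mulVec_inv_mulVec y x, sympForm_mulVec_mulVec y.2, mulVec_inv_mulVec]

theorem sympForm_eq_zero_of_mem_compl {s : Set p} {x y : p ⊕ p → k} (hx : x ∈ coordSubspace k s)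
    (hy : y ∈ coordSubspace k sᶜ) : sympForm k p x y = 0 := by
  rw [sympForm_apply]
  refine Finset.sum_eq_zero fun i _ => ?_
  by_cases hi : i ∈ s
  · simp [hy i (by simpa using hi)]
  · simp [hx i hi]

theorem mem_coordSubspace_of_sympForm {s : Set p} {x : p ⊕ p → k}
    (h : ∀ z ∈ coordSubspace k sᶜ, sympForm k p z x = 0) : x ∈ coordSubspace k s := fun i hi =>
  ⟨by simpa [sympForm_single_inr] using h _ (single_inr_mem_coordSubspace hi),
    by simpa [sympForm_single_inl] using h _ (single_inl_mem_coordSubspace hi)⟩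

theorem exists_sympForm_ne_zero {s : Set p} {u : p ⊕ p → k} (hu : u ∈ coordSubspace k s)
    (hu0 : u ≠ 0) : ∃ w ∈ coordSubspace k s, sympForm k p w u ≠ 0 := by
  obtain ⟨i | i, hi⟩ := Function.ne_iff.1 hu0
  · have his : i ∈ s := by_contra fun h => hi (hu i h).1
    exact ⟨_, single_inr_mem_coordSubspace his, by simpa [sympForm_single_inr] using hi⟩
  · have his : i ∈ s := by_contra fun h => hi (hu i h).2
    exact ⟨_, single_inl_mem_coordSubspace his, by simpa [sympForm_single_inl] using hi⟩

theorem disjoint_coordSubspace (s : Set p) {x : p ⊕ p → k} (h : x ∈ coordSubspace k s)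
    (h' : x ∈ coordSubspace k sᶜ) : x = 0 := by
  by_contra h0
  obtain ⟨w, hw, hw0⟩ := exists_sympForm_ne_zero h h0
  exact hw0 (sympForm_eq_zero_of_mem_compl hw h')

theorem transvection_mulVec_of_mem_compl {s : Set p} {v : p ⊕ p → k}
    (hv : v ∈ coordSubspace k s) (c : k) {x : p ⊕ p → k} (hx : x ∈ coordSubspace k sᶜ) :
    (transvection v c).1 *ᵥ x = x := by
  simp [transvection_mulVec, sympForm_eq_zero_of_mem_compl hv hx]

theorem transvection_sub_mulVec {u v : p ⊕ p → k} (h : sympForm k p v u ≠ 0) :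
    (transvection (v - u) (sympForm k p v u)⁻¹).1 *ᵥ u = v := by
  simp [transvection_mulVec, h]

/-- Transvections along vectors of `coordSubspace k s` act transitively on its nonzero vectors. -/
theorem exists_mulVec_eq {G : Subgroup (symplecticGroup p k)} {s : Set p}
    (hG : ∀ w ∈ coordSubspace k s, ∀ c, transvection w c ∈ G) {u v : p ⊕ p → k}
    (hu : u ∈ coordSubspace k s) (hv : v ∈ coordSubspace k s) (hu0 : u ≠ 0) (hv0 : v ≠ 0) :
    ∃ t ∈ G, t.1 *ᵥ u = v ∧ ∀ x ∈ coordSubspace k sᶜ, t.1 *ᵥ x = x := by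
  have step {u v : p ⊕ p → k} (hu : u ∈ coordSubspace k s) (hv : v ∈ coordSubspace k s)
      (h : sympForm k p v u ≠ 0) :
      ∃ t ∈ G, t.1 *ᵥ u = v ∧ ∀ x ∈ coordSubspace k sᶜ, t.1 *ᵥ x = x :=
    ⟨_, hG _ (sub_mem hv hu) _, transvection_sub_mulVec h, fun x hx =>
      transvection_mulVec_of_mem_compl (sub_mem hv hu) _ hx⟩
  -- An intermediate vector `w` orthogonal to neither `u` nor `v`.
  obtain ⟨w, hw, hwu, hwv⟩ : ∃ w ∈ coordSubspace k s, sympForm k p w u ≠ 0 ∧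
      sympForm k p w v ≠ 0 := by
    obtain ⟨w₁, hw₁, h₁⟩ := exists_sympForm_ne_zero hu hu0
    obtain ⟨w₂, hw₂, h₂⟩ := exists_sympForm_ne_zero hv hv0
    by_cases h₃ : sympForm k p w₁ v = 0
    · by_cases h₄ : sympForm k p w₂ u = 0
      · exact ⟨w₁ + w₂, add_mem hw₁ hw₂, by simpa [h₄] using h₁, by simpa [h₃] using h₂⟩
      · exact ⟨w₂, hw₂, h₄, h₂⟩
    · exact ⟨w₁, hw₁, h₁, h₃⟩
  obtain ⟨t₁, ht₁, h₁, h₁'⟩ := step hu hw hwu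
  obtain ⟨t₂, ht₂, h₂, h₂'⟩ := step hw hv (by rw [sympForm_swap]; simpa using hwv)
  exact ⟨t₂ * t₁, mul_mem ht₂ ht₁, by rw [mul_mulVec, h₁, h₂], fun x hx => by
    rw [mul_mulVec, h₁' x hx, h₂' x hx]⟩

/-- Transvections along vectors of `coordSubspace k s` that fix `e` act transitively on the
vectors of `coordSubspace k s` having a given nonzero product with `e`. -/
theorem exists_mulVec_eq_of_sympForm_eq {G : Subgroup (symplecticGroup p k)} {s : Set p}
    (hG : ∀ w ∈ coordSubspace k s, ∀ c, transvection w c ∈ G) {e u v : p ⊕ p → k}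
    (he : e ∈ coordSubspace k s) (hu : u ∈ coordSubspace k s) (hv : v ∈ coordSubspace k s)
    (hu0 : sympForm k p e u ≠ 0) (huv : sympForm k p e v = sympForm k p e u) :
    ∃ t ∈ G, t.1 *ᵥ e = e ∧ t.1 *ᵥ u = v ∧ ∀ x ∈ coordSubspace k sᶜ, t.1 *ᵥ x = x := by
  have step {u v : p ⊕ p → k} (hu : u ∈ coordSubspace k s) (hv : v ∈ coordSubspace k s)
      (huv : sympForm k p e v = sympForm k p e u) (h : sympForm k p v u ≠ 0) :
      ∃ t ∈ G, t.1 *ᵥ e = e ∧ t.1 *ᵥ u = v ∧ ∀ x ∈ coordSubspace k sᶜ, t.1 *ᵥ x = x :=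
    ⟨_, hG _ (sub_mem hv hu) (sympForm k p v u)⁻¹,
      by simp [transvection_mulVec, sympForm_swap _ e, huv],
      transvection_sub_mulVec h, fun x hx =>
      transvection_mulVec_of_mem_compl (sub_mem hv hu) _ hx⟩
  by_cases h : sympForm k p v u = 0
  -- If `u` and `v` are orthogonal, pass through `e + u`.
  · obtain ⟨t₁, ht₁, h₁, h₁', h₁''⟩ := step hu (add_mem he hu) (by simp) (by simpa using hu0)
    obtain ⟨t₂, ht₂, h₂, h₂', h₂''⟩ := step (add_mem he hu) hv (by simpa using huv)
      (by simpa [h, sympForm_swap v e, huv] using hu0)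
    exact ⟨t₂ * t₁, mul_mem ht₂ ht₁, by rw [mul_mulVec, h₁, h₂], by rw [mul_mulVec, h₁', h₂'],
      fun x hx => by rw [mul_mulVec, h₁'' x hx, h₂'' x hx]⟩
  · exact step hu hv huv h

/-- The symplectic group is generated by transvections. -/
theorem eq_top_of_transvection_mem {G : Subgroup (symplecticGroup p k)}
    (hG : ∀ w c, transvection w c ∈ G) : G = ⊤ := by
  -- A symplectic matrix that fixes all coordinate pairs outside `s` can be multiplied by elements
  -- of `G` until it also fixes one of the pairs in `s`.
  suffices key : ∀ s : Finset p, ∀ y : symplecticGroup p k,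
      (∀ x ∈ coordSubspace k (s : Set p)ᶜ, y.1 *ᵥ x = x) → y ∈ G from
    (Subgroup.eq_top_iff' _).2 fun y => key Finset.univ y fun x hx => by
      obtain rfl : x = 0 := funext fun j => by
        rcases j with i | i
        · exact (hx i (by simp)).1
        · exact (hx i (by simp)).2
      simp
  intro s
  induction s using Finset.induction_on with
  | empty =>
    intro y hy
    obtain rfl : y = 1 := symplecticGroup_ext fun x => by
      rw [hy x fun i hi => absurd (by simp) hi]
      exact (one_mulVec x).symm
    exact one_mem G
  | insert i s _ ih =>
    intro y hy
    set S : Set p := ↑(insert i s) with hS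
    have hi : i ∈ S := by simp [hS]
    have maps {z : symplecticGroup p k} (hz : ∀ x ∈ coordSubspace k Sᶜ, z.1 *ᵥ x = x)
        {x : p ⊕ p → k} (hx : x ∈ coordSubspace k S) : z.1 *ᵥ x ∈ coordSubspace k S :=
      mem_coordSubspace_of_sympForm fun w hw => by
        rw [← hz w hw, sympForm_mulVec_mulVec z.2, sympForm_swap,
          sympForm_eq_zero_of_mem_compl hx hw, neg_zero]
    set e : p ⊕ p → k := Pi.single (.inl i) 1 with he
    set f : p ⊕ p → k := Pi.single (.inr i) 1 with hf
    have heS : e ∈ coordSubspace k S := single_inl_mem_coordSubspace hi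
    have hfS : f ∈ coordSubspace k S := single_inr_mem_coordSubspace hi
    have hef : sympForm k p e f = -1 := by simp [he, hf, sympForm_single_inl]
    have he0 : e ≠ 0 := by simp [he]
    obtain ⟨t₁, ht₁, h₁, h₁'⟩ := exists_mulVec_eq (fun w _ => hG w) (maps hy heS) heS
      (mulVec_ne_zero he0) he0
    have hy₁ : ∀ x ∈ coordSubspace k Sᶜ, (t₁ * y).1 *ᵥ x = x := fun x hx => by
      rw [mul_mulVec, hy x hx, h₁' x hx]
    have hy₁e : (t₁ * y).1 *ᵥ e = e := by rw [mul_mulVec, h₁]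
    have hprod : sympForm k p e ((t₁ * y).1 *ᵥ f) = -1 := by
      conv_lhs => rw [← hy₁e]
      rw [sympForm_mulVec_mulVec (t₁ * y).2, hef]
    obtain ⟨t₂, ht₂, h₂, h₂f, h₂'⟩ := exists_mulVec_eq_of_sympForm_eq (fun w _ => hG w) heS
      (maps hy₁ hfS) hfS (hprod ▸ neg_ne_zero.2 one_ne_zero) (by rw [hprod, hef])
    have : t₂ * (t₁ * y) ∈ G := ih _ fun x hx => by
      obtain ⟨r, hr, hx'⟩ : ∃ r ∈ coordSubspace k Sᶜ, x = r + x (.inl i) • e + x (.inr i) • f := by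
        refine ⟨x - x (.inl i) • e - x (.inr i) • f, fun j hj => ?_, by abel⟩
        rcases eq_or_ne j i with rfl | hji
        · simp [he, hf]
        · have := hx j (by simpa [hS, hji] using hj)
          simp [he, hf, hji, this]
      rw [hx', mul_mulVec]
      simp only [mulVec_add, mulVec_smul]
      rw [hy₁ r hr, hy₁e, h₂' r hr, h₂, h₂f]
    exact (mul_mem_cancel_left ht₁).1 ((mul_mem_cancel_left ht₂).1 this)

end Transvections

/-! ### Subgroups containing the transvections of two complementary coordinate subspaces -/

section Dichotomy

variable {k p : Type*} [Field k] [Fintype p]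

/-- A subspace mapped into the union of two subspaces is mapped into one of them. -/
theorem mulVec_mem_or_mulVec_mem {A : Matrix (p ⊕ p) (p ⊕ p) k}
    {U V W : Submodule k (p ⊕ p → k)} (h : ∀ x ∈ U, A *ᵥ x ∈ V ∨ A *ᵥ x ∈ W) :
    (∀ x ∈ U, A *ᵥ x ∈ V) ∨ (∀ x ∈ U, A *ᵥ x ∈ W) := by
  by_contra! hc
  obtain ⟨⟨x, hx, hxV⟩, ⟨y, hy, hyW⟩⟩ := hc
  have hxW := (h x hx).resolve_left hxV
  have hyV := (h y hy).resolve_right hyW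
  rcases h _ (add_mem hx hy) with h' | h' <;> rw [mulVec_add] at h'
  · exact hxV ((Submodule.add_mem_iff_left V hyV).1 h')
  · exact hyW ((Submodule.add_mem_iff_right W hxW).1 h')

variable [DecidableEq p]

/-- If the transvections along one vector with nonzero components in both `coordSubspace k s` and
`coordSubspace k sᶜ` are in `G`, then by transitivity on pairs of nonzero vectors so are all
transvections. -/
theorem eq_top_of_transvection_mem_of_notMem {G : Subgroup (symplecticGroup p k)} {s : Set p}
    (h₁ : ∀ w ∈ coordSubspace k s, ∀ c, transvection w c ∈ G)
    (h₂ : ∀ w ∈ coordSubspace k sᶜ, ∀ c, transvection w c ∈ G) {z : p ⊕ p → k}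
    (hz₁ : z ∉ coordSubspace k s) (hz₂ : z ∉ coordSubspace k sᶜ)
    (hz : ∀ c, transvection z c ∈ G) : G = ⊤ := by
  refine eq_top_of_transvection_mem fun w c => ?_
  obtain ⟨a, ha, b, hb, rfl⟩ := exists_add_of_coordSubspace s w
  obtain ⟨u, hu, v, hv, rfl⟩ := exists_add_of_coordSubspace s z
  rcases eq_or_ne a 0 with rfl | ha0
  · exact h₂ _ (by simpa using hb) c
  rcases eq_or_ne b 0 with rfl | hb0
  · exact h₁ _ (by simpa using ha) c
  have hu0 : u ≠ 0 := fun h => hz₂ (by simpa [h] using hv)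
  have hv0 : v ≠ 0 := fun h => hz₁ (by simpa [h] using hu)
  obtain ⟨t, ht, htu, htx⟩ := exists_mulVec_eq h₁ hu ha hu0 ha0
  obtain ⟨r, hr, hrv, hrx⟩ := exists_mulVec_eq h₂ hv hb hv0 hb0
  rw [compl_compl] at hrx
  have : (r * t).1 *ᵥ (u + v) = a + b := by
    rw [mul_mulVec, mulVec_add, htu, htx v hv, mulVec_add, hrx a ha, hrv]
  rw [← this, ← conj_transvection]
  exact mul_mem (mul_mem (mul_mem hr ht) (hz c)) (inv_mem (mul_mem hr ht))

/-- The symplectic matrices mapping `coordSubspace k s` into `coordSubspace k s'`. -/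
def mapsCoord (k : Type*) {p : Type*} [Field k] [Fintype p] [DecidableEq p] (s s' : Set p) :
    Set (symplecticGroup p k) :=
  {y | ∀ x ∈ coordSubspace k s, y.1 *ᵥ x ∈ coordSubspace k s'}

theorem transvection_mem_mapsCoord {s : Set p} {w : p ⊕ p → k} (hw : w ∈ coordSubspace k s)
    (c : k) : transvection w c ∈ mapsCoord k s s ∧ transvection w c ∈ mapsCoord k sᶜ sᶜ := by
  refine ⟨fun x hx => ?_, fun x hx => ?_⟩
  · rw [transvection_mulVec]
    exact add_mem hx (Submodule.smul_mem _ _ hw)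
  · rwa [transvection_mulVec_of_mem_compl hw c hx]

theorem apply_eq_zero_of_mapsCoord {s s' : Set p} {y : symplecticGroup p k}
    (hy : y ∈ mapsCoord k s s') {i j : p ⊕ p} (hj : Sum.elim id id j ∈ s)
    (hi : Sum.elim id id i ∉ s') : y.1 i j = 0 := by
  have h : (Pi.single j 1 : p ⊕ p → k) ∈ coordSubspace k s := by
    rcases j with j | j
    · exact single_inl_mem_coordSubspace hj
    · exact single_inr_mem_coordSubspace hj
  have := hy _ h
  rw [mulVec_single_one] at this
  rcases i with i | i
  · exact (this i hi).1
  · exact (this i hi).2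

/-- A subgroup containing all transvections along vectors of two complementary coordinate subspaces
is the whole group unless its elements preserve or exchange the two subspaces: otherwise
a conjugate of such a transvection has its direction outside both subspaces. -/
theorem eq_top_or_mapsCoord {G : Subgroup (symplecticGroup p k)} {s : Set p}
    (h₁ : ∀ w ∈ coordSubspace k s, ∀ c, transvection w c ∈ G)
    (h₂ : ∀ w ∈ coordSubspace k sᶜ, ∀ c, transvection w c ∈ G) :
    G = ⊤ ∨ (G : Set (symplecticGroup p k)) ⊆
      (mapsCoord k s s ∩ mapsCoord k sᶜ sᶜ) ∪ (mapsCoord k s sᶜ ∩ mapsCoord k sᶜ s) := by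
  refine or_iff_not_imp_left.2 fun hG y hy => ?_
  have key (v : p ⊕ p → k) (hv : ∀ c, transvection v c ∈ G) :
      y.1 *ᵥ v ∈ coordSubspace k s ∨ y.1 *ᵥ v ∈ coordSubspace k sᶜ := by
    by_contra! h
    refine hG (eq_top_of_transvection_mem_of_notMem h₁ h₂ h.1 h.2 fun c => ?_)
    rw [← conj_transvection]
    exact mul_mem (mul_mem hy (hv c)) (inv_mem hy)
  -- If `y` maps the whole space into one subspace, then the other one vanishes.
  have collapse {s : Set p} (h : y ∈ mapsCoord k s s) (h' : y ∈ mapsCoord k sᶜ s) :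
      y ∈ mapsCoord k sᶜ sᶜ := fun x hx => by
    have hx0 : x = 0 := by
      refine disjoint_coordSubspace s ?_ hx
      obtain ⟨a, ha, b, hb, hab⟩ := exists_add_of_coordSubspace s (y⁻¹.1 *ᵥ x)
      rw [← mulVec_inv_mulVec y x, hab, mulVec_add]
      exact add_mem (h a ha) (h' b hb)
    simp [hx0]
  rcases mulVec_mem_or_mulVec_mem fun x hx => key x (h₁ x hx) with hs | hs <;>
    rcases mulVec_mem_or_mulVec_mem fun x hx => key x (h₂ x hx) with hs' | hs'
  · exact .inl ⟨hs, collapse hs hs'⟩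
  · exact .inl ⟨hs, hs'⟩
  · exact .inr ⟨hs, hs'⟩
  · refine .inl ⟨?_, hs'⟩
    have := @collapse sᶜ hs' (by rwa [compl_compl])
    rwa [compl_compl] at this

end Dichotomy

/-! ### Block-diagonal symplectic matrices -/

section BlockDiagonal

variable {k l m p : Type*} [Field k]

theorem prodMatrix_inj (e : l ⊕ m ≃ p) {A A' : Matrix (l ⊕ l) (l ⊕ l) k}
    {B B' : Matrix (m ⊕ m) (m ⊕ m) k} (h : prodMatrix e A B = prodMatrix e A' B') :
    A = A' ∧ B = B' := by
  have := fromBlocks_inj.1 ((Matrix.reindex _ _).injective h)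
  exact ⟨this.1, this.2.2.2⟩

variable [Fintype l] [DecidableEq l] [Fintype m] [DecidableEq m] [Fintype p] [DecidableEq p]

theorem mem_symplecticGroup_of_prodMatrix (e : l ⊕ m ≃ p) {A : Matrix (l ⊕ l) (l ⊕ l) k}
    {B : Matrix (m ⊕ m) (m ⊕ m) k} (h : prodMatrix e A B ∈ symplecticGroup p k) :
    A ∈ symplecticGroup l k ∧ B ∈ symplecticGroup m k := by
  rw [SymplecticGroup.mem_iff, ← prodMatrix_J e, prodMatrix_transpose, prodMatrix_mul,
    prodMatrix_mul] at h
  rw [SymplecticGroup.mem_iff, SymplecticGroup.mem_iff]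
  exact prodMatrix_inj e h

/-- Block-diagonal symplectic matrices are those that preserve both coordinate subspaces. -/
theorem mem_range_prodHom (e : l ⊕ m ≃ p) {y : symplecticGroup p k}
    (h : y ∈ mapsCoord k (Set.range (e ∘ Sum.inl)) (Set.range (e ∘ Sum.inl)))
    (h' : y ∈ mapsCoord k (Set.range (e ∘ Sum.inl))ᶜ (Set.range (e ∘ Sum.inl))ᶜ) :
    y ∈ (prodHom k e).range := by
  set s : Set p := Set.range (e ∘ Sum.inl)
  set σ := (Equiv.sumSumSumComm l l m m).trans (Equiv.sumCongr e e)
  have hl (i : l ⊕ l) : Sum.elim id id (σ (.inl i)) ∈ s := by rcases i with i | i <;> exact ⟨i, rfl⟩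
  have hm (i : m ⊕ m) : Sum.elim id id (σ (.inr i)) ∉ s := by
    rcases i with i | i
    all_goals
      rintro ⟨j, hj⟩
      exact Sum.inl_ne_inr (e.injective hj)
  set N := y.1.submatrix σ σ with hN
  have h₁₂ : N.toBlocks₁₂ = 0 := by
    ext i j
    exact apply_eq_zero_of_mapsCoord h' (hm j) (not_not.2 (hl i))
  have h₂₁ : N.toBlocks₂₁ = 0 := by
    ext i j
    exact apply_eq_zero_of_mapsCoord h (hl j) (hm i)
  have hy : prodMatrix e N.toBlocks₁₁ N.toBlocks₂₂ = y.1 := by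
    have : fromBlocks N.toBlocks₁₁ 0 0 N.toBlocks₂₂ = N := by
      conv_rhs => rw [← fromBlocks_toBlocks N, h₁₂, h₂₁]
    rw [prodMatrix, this, hN]
    exact (Matrix.reindex σ σ).apply_symm_apply y.1
  have hmem := mem_symplecticGroup_of_prodMatrix e (hy ▸ y.2)
  exact ⟨(⟨_, hmem.1⟩, ⟨_, hmem.2⟩), Subtype.ext hy⟩

end BlockDiagonal

/-! ### Zariski-closed conditions -/

section Zariski

variable {k ι : Type*} [Field k] [Fintype ι] [DecidableEq ι]

theorem isClosed_setOf_linearMap_eq_zero (f : Matrix ι ι k →ₗ[k] k) :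
    @IsClosed _ (zariskiMatrix k ι) {M | f M = 0} := by
  refine @IsClosed.mk _ (zariskiMatrix k ι) _ ?_
  change {M | f M = 0}ᶜᶜ ∈ Set.range matrixZeros
  rw [compl_compl]
  refine ⟨{∑ i, ∑ j, MvPolynomial.C (f (single i j 1)) * MvPolynomial.X (i, j)}, ?_⟩
  ext M
  have : f M = ∑ i, ∑ j, f (single i j 1) * M i j := by
    conv_lhs => rw [matrix_eq_sum_single M]
    simp only [map_sum]
    refine Finset.sum_congr rfl fun i _ => Finset.sum_congr rfl fun j _ => ?_
    rw [mul_comm, ← smul_eq_mul, ← map_smul, smul_single, smul_eq_mul, mul_one]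
  simp [matrixZeros, this]

theorem isClosed_preimage_conj_mapsCoord {n : ℕ} (g : symplecticGroup (Fin n) k)
    (s s' : Set (Fin n)) :
    @IsClosed _ (zariskiSp k n) {y | g⁻¹ * y * g ∈ mapsCoord k s s'} := by
  let := zariskiMatrix k (Fin n ⊕ Fin n)
  let := zariskiSp k n
  let f (z x : Fin n ⊕ Fin n → k) : Matrix (Fin n ⊕ Fin n) (Fin n ⊕ Fin n) k →ₗ[k] k :=
    { toFun := fun M => sympForm k (Fin n) z ((g⁻¹.1 * M * g.1) *ᵥ x)
      map_add' := fun M N => by simp [mul_add, add_mul, add_mulVec]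
      map_smul' := fun c M => by simp [smul_mulVec] }
  have : {y | g⁻¹ * y * g ∈ mapsCoord k s s'} = ⋂ x ∈ coordSubspace k s,
      ⋂ z ∈ coordSubspace k s'ᶜ, Subtype.val ⁻¹' {M | f z x M = 0} := by
    ext y
    simp only [Set.mem_iInter]
    refine ⟨fun h x hx z hz => ?_, fun h x hx => mem_coordSubspace_of_sympForm (h x hx)⟩
    change sympForm k (Fin n) z _ = 0
    rw [sympForm_swap]
    exact neg_eq_zero.2 (sympForm_eq_zero_of_mem_compl (h x hx) hz)
  rw [this]
  exact isClosed_biInter fun x _ => isClosed_biInter fun z _ =>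
    (isClosed_setOf_linearMap_eq_zero (f z x)).preimage continuous_induced_dom

end Zariski

end SpSub

open SpSub in
theorem mainTheorem4 {k : Type*} [Field k] [CharZero k] {a n : ℕ} (han : a ≤ n)
    (G : Subgroup (Matrix.symplecticGroup (Fin n) k))
    (hG : SpSub.IsAlgebraicSubgroup G) (hconn : SpSub.IsConnectedSubgroup G)
    (hss : SpSub.IsSemisimpleSubgroup G)
    (g : Matrix.symplecticGroup (Fin n) k)
    (hle : (SpSub.spProd k han).map (MulAut.conj g).toMonoidHom ≤ G) :
    G = (SpSub.spProd k han).map (MulAut.conj g).toMonoidHom ∨ G = ⊤ := by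
  set e : Fin a ⊕ Fin (n - a) ≃ Fin n :=
    finSumFinEquiv.trans (finCongr (Nat.add_sub_of_le han))
  set s : Set (Fin n) := Set.range (e ∘ Sum.inl)
  have hH {y} (h : y ∈ mapsCoord k s s ∧ y ∈ mapsCoord k sᶜ sᶜ) : y ∈ spProd k han :=
    mem_range_prodHom e h.1 h.2
  have hle' := Subgroup.map_le_iff_le_comap.1 hle
  have hconj (y) : y ∈ G.comap (MulAut.conj g).toMonoidHom ↔ g * y * g⁻¹ ∈ G := Iff.rfl
  rcases eq_top_or_mapsCoord (G := G.comap (MulAut.conj g).toMonoidHom) (s := s)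
    (fun w hw c => hle' (hH (transvection_mem_mapsCoord hw c)))
    (fun w hw c => hle' (hH (by
      have := transvection_mem_mapsCoord hw c
      rw [compl_compl] at this
      exact this.symm))) with h | h
  · refine .inr ((Subgroup.eq_top_iff' _).2 fun y => ?_)
    have : g⁻¹ * y * g ∈ G.comap (MulAut.conj g).toMonoidHom := h ▸ Subgroup.mem_top _
    rw [hconj] at this
    simpa [mul_assoc] using this
  · refine .inl (le_antisymm (fun y hy => ?_) hle)
    have hcover : (G : Set (Matrix.symplecticGroup (Fin n) k)) ⊆
        {y | g⁻¹ * y * g ∈ mapsCoord k s s ∩ mapsCoord k sᶜ sᶜ} ∪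
        {y | g⁻¹ * y * g ∈ mapsCoord k s sᶜ ∩ mapsCoord k sᶜ s} := fun y hy =>
      h ((hconj _).2 (by simpa [mul_assoc] using hy))
    let := zariskiSp k n
    have hclosed (s₁ s₂ s₃ s₄ : Set (Fin n)) :
        IsClosed {y | g⁻¹ * y * g ∈ mapsCoord k s₁ s₂ ∩ mapsCoord k s₃ s₄} :=
      (isClosed_preimage_conj_mapsCoord g s₁ s₂).inter (isClosed_preimage_conj_mapsCoord g s₃ s₄)
    suffices hmem : g⁻¹ * y * g ∈ mapsCoord k s s ∩ mapsCoord k sᶜ sᶜ from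
      ⟨_, hH hmem, by simp [mul_assoc]⟩
    by_contra hy'
    have hone : g⁻¹ * 1 * g ∈ mapsCoord k s s ∩ mapsCoord k sᶜ sᶜ := by
      rw [mul_one, inv_mul_cancel]
      exact ⟨fun x hx => by simpa using hx, fun x hx => by simpa using hx⟩
    -- An element that both preserves and exchanges the two subspaces forces them to vanish, and
    -- then the condition that `y` violates is vacuous.
    obtain ⟨z, -, hz₁, hz₂⟩ := isPreconnected_closed_iff.1 hconn.isPreconnected _ _
      (hclosed s s sᶜ sᶜ) (hclosed s sᶜ sᶜ s) hcover
      ⟨1, one_mem G, hone⟩ ⟨y, hy, (hcover hy).resolve_left hy'⟩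
    have h₁ {x} (hx : x ∈ coordSubspace k s) : x = 0 := by
      by_contra hx0
      exact mulVec_ne_zero hx0 (disjoint_coordSubspace s (hz₁.1 x hx) (hz₂.1 x hx))
    have h₂ {x} (hx : x ∈ coordSubspace k sᶜ) : x = 0 := by
      by_contra hx0
      exact mulVec_ne_zero hx0 (disjoint_coordSubspace s (hz₂.2 x hx) (hz₁.2 x hx))
    exact hy' ⟨fun x hx => by simp [h₁ hx], fun x hx => by simp [h₂ hx]⟩
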